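/- For groups $\Gamma,\Lambda$, let $S=\Gamma\cup\Lambda$ be the union of set models of $\Gamma$ and $\Lambda$ in which the two identity elements are identified and which are otherwise disjoint. Let $\Gamma$ act on $S$ by left translation on $\Gamma$ and by fixing every element of $\Lambda\setminus\{e\}$, and let $\Lambda$ act on $S$ by left translation on $\Lambda$ and by fixing every element of $\Gamma\setminus\{e\}$. Let $\Gamma\vee\Lambda$ be the subgroup of $\mathrm{Sym}(S)$ generated by these two actions. For a complex $k\times k$ matrix $M$ let $\|M\|_p=\big(\mathrm{Tr}((M^*M)^{p/2})\big)^{1/p}$ for $1\le p<\infty$, and let $\|M\|_\infty$ be the operator norm. A countable discrete group $G$ is *stable in the unnormalized Schatten $p$-norm* if for every sequence of positive integers $k_n$ and every sequence of functions $\varphi_n:G\to U_{k_n}$ to the group of unitary $k_n\times k_n$ matrices such that $\|\varphi_n(gh)-\varphi_n(g)\varphi_n(h)\|_p\to0$ for all $g,h\in G$, there are group homomorphisms $\psi_n:G\to U_{k_n}$ such that $\|\psi_n(g)-\varphi_n(g)\|_p\to0$ for all $g\in G$. **Corollary.** Let $1<p\le\infty$, and let $\Gamma$ and $\Lambda$ be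 finitely generated groups such that $H^1(\Gamma;\mathbb Z)=\mathrm{Hom}(\Gamma,\mathbb Z)$ and $H^1(\Lambda;\mathbb Z)=\mathrm{Hom}(\Lambda,\mathbb Z)$ are both nontrivial. Then $\Gamma\vee\Lambda$ is not stable in the unnormalized Schatten $p$-norm. -/

import Mathlib

open Filter Topology
open scoped ENNReal

noncomputable section

/-- The unnormalized Schatten `p`-norm of a complex `k × k` matrix:
`(Tr ((M* M) ^ (p / 2))) ^ (1 / p)` for `p < ∞`, where the power of the positive semidefinite
matrix `M* M` is taken in the functional calculus (the trace is then a nonnegative real number),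
and the operator norm on Euclidean space for `p = ∞`. -/
def schattenNorm (p : ℝ≥0∞) {k : ℕ} (M : Matrix (Fin k) (Fin k) ℂ) : ℝ :=
  open scoped MatrixOrder in
  if p = ∞ then ‖Matrix.toEuclideanCLM (n := Fin k) (𝕜 := ℂ) M‖
  else (Matrix.trace ((M.conjTranspose * M) ^ (p.toReal / 2))).re ^ (1 / p.toReal)

/-- A sequence of functions `φ n : G → U (k n)` is an asymptotic homomorphism for the Schatten
`p`-norm if `‖φ n (g h) - φ n g φ n h‖_p → 0` for all `g`, `h`. -/
def IsAsymptoticHom (p : ℝ≥0∞) {G : Type*} [Group G] {k : ℕ → ℕ}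
    (φ : ∀ n, G → Matrix.unitaryGroup (Fin (k n)) ℂ) : Prop :=
  ∀ g h : G, Tendsto (fun n => schattenNorm p
    ((φ n (g * h) : Matrix (Fin (k n)) (Fin (k n)) ℂ)
      - (φ n g : Matrix (Fin (k n)) (Fin (k n)) ℂ) * (φ n h : Matrix (Fin (k n)) (Fin (k n)) ℂ)))
    atTop (𝓝 0)

/-- A sequence of functions `φ n : G → U (k n)` is perturbable to homomorphisms for the Schatten
`p`-norm if there are homomorphisms `ψ n : G → U (k n)` with `‖ψ n g - φ n g‖_p → 0` for
all `g`. -/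
def IsPerturbableToHoms (p : ℝ≥0∞) {G : Type*} [Group G] {k : ℕ → ℕ}
    (φ : ∀ n, G → Matrix.unitaryGroup (Fin (k n)) ℂ) : Prop :=
  ∃ ψ : ∀ n, G →* Matrix.unitaryGroup (Fin (k n)) ℂ,
    ∀ g : G, Tendsto (fun n => schattenNorm p
      ((ψ n g : Matrix (Fin (k n)) (Fin (k n)) ℂ) - (φ n g : Matrix (Fin (k n)) (Fin (k n)) ℂ)))
      atTop (𝓝 0)

/-- A (countable discrete) group is stable in the unnormalized Schatten `p`-norm if every
asymptotic homomorphism to finite-dimensional unitary groups is perturbable to homomorphisms. -/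
def IsSchattenStable (p : ℝ≥0∞) (G : Type*) [Group G] : Prop :=
  ∀ (k : ℕ → ℕ), (∀ n, 0 < k n) → ∀ φ : ∀ n, G → Matrix.unitaryGroup (Fin (k n)) ℂ,
    IsAsymptoticHom p φ → IsPerturbableToHoms p φ

/-- The first cohomology group `H¹(Γ; ℤ) = Hom(Γ, ℤ)` (trivial action on `ℤ`). -/
abbrev IntegerH1 (Γ : Type*) [Group Γ] : Type _ := Additive Γ →+ ℤ

/-- The set `S = Γ ∪ Λ`, in which the two identity elements are identified and which is otherwise
a disjoint union, realized as `(Γ × {1}) ∪ ({1} × Λ)` inside `Γ × Λ`. -/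
def VeeSet (Γ Λ : Type*) [Group Γ] [Group Λ] : Type _ :=
  {x : Γ × Λ // x.1 = 1 ∨ x.2 = 1}

/-- The inclusion of `Γ` into `S`. -/
def VeeSet.inl (Γ Λ : Type*) [Group Γ] [Group Λ] : Γ ↪ VeeSet Γ Λ where
  toFun g := ⟨(g, 1), Or.inr rfl⟩
  inj' _ _ h := congrArg (fun x : VeeSet Γ Λ => x.1.1) h

/-- The inclusion of `Λ` into `S`. -/
def VeeSet.inr (Γ Λ : Type*) [Group Γ] [Group Λ] : Λ ↪ VeeSet Γ Λ where
  toFun l := ⟨(1, l), Or.inl rfl⟩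
  inj' _ _ h := congrArg (fun x : VeeSet Γ Λ => x.1.2) h

/-- The action of `Γ` on `S`: left translation on `Γ`, and every element of `Λ \ {1}`
is fixed. -/
def veeActionLeft (Γ Λ : Type*) [Group Γ] [Group Λ] : Γ →* Equiv.Perm (VeeSet Γ Λ) :=
  (Equiv.Perm.viaEmbeddingHom (VeeSet.inl Γ Λ)).comp (MulAction.toPermHom Γ Γ)

/-- The action of `Λ` on `S`: left translation on `Λ`, and every element of `Γ \ {1}`
is fixed. -/
def veeActionRight (Γ Λ : Type*) [Group Γ] [Group Λ] : Λ →* Equiv.Perm (VeeSet Γ Λ) :=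
  (Equiv.Perm.viaEmbeddingHom (VeeSet.inr Γ Λ)).comp (MulAction.toPermHom Λ Λ)

/-- The group `Γ ∨ Λ`: the subgroup of `Sym(S)` generated by the actions of `Γ` and `Λ`. -/
def veeGroup (Γ Λ : Type*) [Group Γ] [Group Λ] : Subgroup (Equiv.Perm (VeeSet Γ Λ)) :=
  (veeActionLeft Γ Λ).range ⊔ (veeActionRight Γ Λ).range

end

/-! Permutations in `Γ ∨ Λ` agree, off a finite set, with a translation on each branch, which gives
a quotient map to `Γ × Λ` and, through nonzero homomorphisms to ℤ, to ℤ². Voiculescu's k × k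
unitaries satisfy vu = ωuv with ω = exp(2πi/k). Pulled back, they have multiplicative defect O(1/k)
times a unitary, of p-norm O(k^(1/p - 1)), which tends to 0 because p > 1
(`isAsymptoticHom_zpow_mul_zpow`).

Genuine homomorphisms ψ to a unitary group are rigid. The commutator of γ and l is a 3-cycle; powers
of ψ(l) return near 1, unitary groups have no small elements of order three, and relations between
3-cycles then force this commutator into the kernel (`commute_map_veeLeft_veeRight`). Nearby
homomorphisms would thus put commuting unitaries close to u^d and v^e. The Exel–Loring winding
number of det((1 - r)UV + rVU) forbids this (`eq_one_of_near_commuting`). The operator norm suffices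
there, being dominated by every Schatten norm. -/

/-! ### Winding numbers through lifts along exp -/

section Winding

/-- The difference f - g lifts the constant path 1 through the covering exp, so it is constant. -/
theorem sub_eq_sub_of_exp_eq {f g : ℝ → ℂ} (hf : Continuous f) (hg : Continuous g)
    (h : ∀ t, Complex.exp (f t) = Complex.exp (g t)) (s t : ℝ) : f t - f s = g t - g s := by
  have key := Complex.isCoveringMap_exp.eq_of_comp_eq (A := ℝ) (g₁ := fun t => f t - g t)
    (g₂ := fun _ => f s - g s) (by fun_prop) (by fun_prop)
    (by
      funext x
      simp only [Function.comp_apply, Complex.exp_sub, h]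
      simp) s rfl
  have := congrFun key t
  linear_combination this

/-- Homotopy invariance of the winding number, expressed through logarithms at the two ends. -/
theorem log_increment_eq_of_homotopy {F : ℝ × ℝ → ℂ} (hF : Continuous F) (h0 : ∀ x, F x ≠ 0)
    (hper : ∀ s, F (s, 0) = F (s, 1)) {l₀ l₁ : ℝ → ℂ} (hl₀ : Continuous l₀) (hl₁ : Continuous l₁)
    (e₀ : ∀ r, Complex.exp (l₀ r) = F (0, r)) (e₁ : ∀ r, Complex.exp (l₁ r) = F (1, r)) :
    l₀ 1 - l₀ 0 = l₁ 1 - l₁ 0 := by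
  obtain ⟨L, ⟨-, hL⟩, -⟩ := Complex.isCoveringMapOn_exp.existsUnique_continuousMap_lifts
    (A := ℝ × ℝ) ⟨F, hF⟩ (a₀ := (0, 0)) (e₀ := Complex.log (F (0, 0)))
    (by simpa using Complex.exp_log (h0 _)) (fun x => by simpa using h0 x)
  have hL' : ∀ x, Complex.exp (L x) = F x := fun x => congrFun hL x
  have a₀ := sub_eq_sub_of_exp_eq hl₀ (g := fun r => L (0, r)) (by fun_prop)
    (fun r => by rw [e₀, hL']) 0 1
  have a₁ := sub_eq_sub_of_exp_eq hl₁ (g := fun r => L (1, r)) (by fun_prop)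
    (fun r => by rw [e₁, hL']) 0 1
  -- Closedness of each loop makes the increment of L across it independent of s.
  have a₂ := sub_eq_sub_of_exp_eq (f := fun s => L (s, 1)) (g := fun s => L (s, 0))
    (by fun_prop) (by fun_prop) (fun s => by rw [hL', hL', hper]) 0 1
  linear_combination a₀ - a₁ - a₂

end Winding

/-! ### Operator norm, Schatten norms and small elements of order three -/

section Norms

open scoped Matrix.Norms.L2Operator

variable {n : Type*} [Fintype n] [DecidableEq n]

theorem Matrix.det_ne_zero_of_norm_sub_unitary_lt_one {M W : Matrix n n ℂ}
    (hW : W ∈ Matrix.unitaryGroup n ℂ) (h : ‖M - W‖ < 1) : M.det ≠ 0 := by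
  have h1 : ‖star W * M - 1‖ < 1 := by
    have : star W * M - 1 = star W * (M - W) := by
      rw [mul_sub, Matrix.mem_unitaryGroup_iff'.1 hW]
    rw [this, CStarRing.norm_mem_unitary_mul _ (Unitary.star_mem hW)]
    exact h
  have h2 : IsUnit (star W * M) := by
    have := isUnit_one_sub_of_norm_lt_one (x := 1 - star W * M) (by rwa [norm_sub_rev])
    simpa using this
  have h3 := ((Matrix.isUnit_iff_isUnit_det _).1 h2).ne_zero
  rw [Matrix.det_mul] at h3
  exact right_ne_zero_of_mul h3

theorem norm_le_one_of_mem_unitaryGroup {W : Matrix n n ℂ}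
    (hW : W ∈ Matrix.unitaryGroup n ℂ) : ‖W‖ ≤ 1 := by
  cases isEmpty_or_nonempty n
  · rw [Subsingleton.elim W 0, norm_zero]; exact zero_le_one
  · exact (CStarRing.norm_of_mem_unitary hW).le

/-- With B = A - 1 one has 0 = A³ - 1 = B(B² + 3B + 3), so x = ‖B‖ satisfies 3x ≤ x(x² + 3x). For x
< 1/2 the last factor is below 7/4, hence x = 0. -/
theorem eq_one_of_pow_three_eq_one_of_norm_lt {A : Matrix n n ℂ} (h3 : A ^ 3 = 1)
    (h : ‖A - 1‖ < 1 / 2) : A = 1 := by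
  have e : (A - 1) * ((A - 1) * (A - 1) + (3 : ℂ) • (A - 1) + (3 : ℂ) • 1) = 0 := by
    have : (A - 1) * ((A - 1) * (A - 1) + (3 : ℂ) • (A - 1) + (3 : ℂ) • 1) = A ^ 3 - 1 := by
      have : (3 : ℂ) • (1 : Matrix n n ℂ) = 3 := by
        rw [← Algebra.algebraMap_eq_smul_one, map_ofNat]
      rw [← mul_one (A - 1), ← mul_smul_comm, this]
      noncomm_ring
    rw [this, h3, sub_self]
  have e2 : (3 : ℂ) • (A - 1) = - ((A - 1) * ((A - 1) * (A - 1) + (3 : ℂ) • (A - 1))) := by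
    rw [mul_add] at e
    rw [eq_neg_iff_add_eq_zero, add_comm, ← e]
    simp
  have e3 : 3 * ‖A - 1‖ ≤ ‖A - 1‖ * (‖A - 1‖ * ‖A - 1‖ + 3 * ‖A - 1‖) := by
    calc 3 * ‖A - 1‖ = ‖(3 : ℂ) • (A - 1)‖ := by rw [norm_smul]; norm_num
      _ = ‖(A - 1) * ((A - 1) * (A - 1) + (3 : ℂ) • (A - 1))‖ := by
        rw [← norm_neg ((A - 1) * _)]; exact congrArg _ e2
      _ ≤ ‖A - 1‖ * ‖(A - 1) * (A - 1) + (3 : ℂ) • (A - 1)‖ := norm_mul_le _ _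
      _ ≤ _ := by
        gcongr
        refine (norm_add_le _ _).trans (add_le_add (norm_mul_le _ _) ?_)
        rw [norm_smul]; norm_num
  have : ‖A - 1‖ = 0 := by
    by_contra hne
    have hpos : 0 < ‖A - 1‖ := lt_of_le_of_ne (norm_nonneg _) (Ne.symm hne)
    nlinarith
  rwa [norm_eq_zero, sub_eq_zero] at this

/-- Every group of unitary matrices is without small elements of order three. -/
theorem Matrix.unitaryGroup.eventually_eq_one_of_pow_three :
    ∀ᶠ x : Matrix.unitaryGroup n ℂ in 𝓝 1, x ^ 3 = 1 → x = 1 := by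
  have hc : Continuous fun x : Matrix.unitaryGroup n ℂ => ‖(x : Matrix n n ℂ) - 1‖ := by fun_prop
  have := hc.tendsto 1
  filter_upwards [this.eventually_lt_const (u := 1 / 2) (by simp)] with x hx h3
  exact Subtype.ext (eq_one_of_pow_three_eq_one_of_norm_lt
    (by rw [← SubmonoidClass.coe_pow, h3]; rfl) hx)

instance Matrix.unitaryGroup.instCompactSpace : CompactSpace (Matrix.unitaryGroup n ℂ) := by
  have hb : Bornology.IsBounded (Matrix.unitaryGroup n ℂ : Set (Matrix n n ℂ)) :=
    isBounded_iff_forall_norm_le.2 ⟨1, fun W hW => norm_le_one_of_mem_unitaryGroup hW⟩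
  have : ProperSpace (Matrix n n ℂ) := FiniteDimensional.proper ℂ _
  exact isCompact_iff_compactSpace.1 (Metric.isCompact_of_isClosed_isBounded (isClosed_unitary) hb)

open scoped ComplexOrder in
theorem norm_le_schattenNorm {p : ℝ≥0∞} (hp : p ≠ 0) {k : ℕ} (M : Matrix (Fin k) (Fin k) ℂ) :
    ‖M‖ ≤ schattenNorm p M := by
  unfold schattenNorm
  split_ifs with h
  · exact le_rfl
  have hq : 0 < p.toReal := ENNReal.toReal_pos hp h
  set q := p.toReal
  have hps : (M.conjTranspose * M).PosSemidef := Matrix.posSemidef_conjTranspose_mul_self M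
  have hA := hps.isHermitian
  have htr : (open scoped MatrixOrder in
      (Matrix.trace ((M.conjTranspose * M) ^ (q / 2))).re) = ∑ i, hA.eigenvalues i ^ (q / 2) := by
    open scoped MatrixOrder in
    rw [CFC.rpow_eq_cfc_real hps.nonneg, hA.cfc_eq, Matrix.IsHermitian.cfc,
      Unitary.conjStarAlgAut_apply, Matrix.trace_mul_cycle]
    simp [Matrix.trace, Complex.re_sum]
  rw [htr]
  have hev : ∀ i, 0 ≤ hA.eigenvalues i := hps.eigenvalues_nonneg
  set S := ∑ i, hA.eigenvalues i ^ (q / 2)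
  have hS : 0 ≤ S := Finset.sum_nonneg fun i _ => Real.rpow_nonneg (hev i) _
  have hle : ∀ i, hA.eigenvalues i ≤ S ^ (1 / q) * S ^ (1 / q) := by
    intro i
    have h1 : hA.eigenvalues i ^ (q / 2) ≤ S :=
      Finset.single_le_sum (f := fun i => hA.eigenvalues i ^ (q / 2))
        (fun i _ => Real.rpow_nonneg (hev i) _) (Finset.mem_univ i)
    -- The exponent 2/q is split as 1/q + 1/q to match ‖M* M‖ = ‖M‖ · ‖M‖ below.
    have h2 := Real.rpow_le_rpow (Real.rpow_nonneg (hev i) _) h1 (z := 1 / q + 1 / q) (by positivity)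
    rw [← Real.rpow_mul (hev i), Real.rpow_add_of_nonneg hS (by positivity) (by positivity),
      show q / 2 * (1 / q + 1 / q) = 1 by field_simp; norm_num, Real.rpow_one] at h2
    exact h2
  have hnorm : ‖M.conjTranspose * M‖ ≤ S ^ (1 / q) * S ^ (1 / q) := by
    rw [hA.spectral_theorem, Unitary.conjStarAlgAut_apply]
    refine (norm_mul_le _ _).trans ?_
    refine (mul_le_of_le_one_right (norm_nonneg _)
      (norm_le_one_of_mem_unitaryGroup (Unitary.star_mem hA.eigenvectorUnitary.2))).trans ?_
    refine (norm_mul_le _ _).trans ?_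
    refine (mul_le_of_le_one_left (norm_nonneg _)
      (norm_le_one_of_mem_unitaryGroup hA.eigenvectorUnitary.2)).trans ?_
    rw [Matrix.l2_opNorm_diagonal, pi_norm_le_iff_of_nonneg (by positivity)]
    intro i
    simpa [abs_of_nonneg (hev i)] using hle i
  rw [Matrix.l2_opNorm_conjTranspose_mul_self] at hnorm
  exact nonneg_le_nonneg_of_sq_le_sq (by positivity) hnorm

theorem schattenNorm_smul_unitary_top {k : ℕ} (c : ℂ) {W : Matrix (Fin k) (Fin k) ℂ}
    (hW : W ∈ Matrix.unitaryGroup (Fin k) ℂ) : schattenNorm ∞ (c • W) ≤ ‖c‖ := by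
  rw [schattenNorm, if_pos rfl]
  change ‖c • W‖ ≤ ‖c‖
  rw [norm_smul]
  exact mul_le_of_le_one_right (norm_nonneg _) (norm_le_one_of_mem_unitaryGroup hW)

theorem schattenNorm_smul_unitary_le {p : ℝ≥0∞} (hp : p ≠ 0) {k : ℕ} (c : ℂ)
    {W : Matrix (Fin k) (Fin k) ℂ} (hW : W ∈ Matrix.unitaryGroup (Fin k) ℂ) :
    schattenNorm p (c • W) ≤ (k : ℝ) ^ (1 / p.toReal) * ‖c‖ := by
  by_cases h : p = ∞
  · subst h
    -- For p = ∞, `p.toReal` is 0 and 1/0 = 0, so the dimension factor is 1.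
    simpa using schattenNorm_smul_unitary_top c hW
  refine le_of_eq ?_
  rw [schattenNorm, if_neg h]
  have hq : 0 < p.toReal := ENNReal.toReal_pos hp h
  set q := p.toReal
  have e : (c • W).conjTranspose * (c • W)
      = algebraMap NNReal (Matrix (Fin k) (Fin k) ℂ) (‖c‖₊ ^ 2) := by
    rw [Matrix.conjTranspose_smul, smul_mul_smul_comm, ← Matrix.star_eq_conjTranspose,
      Matrix.mem_unitaryGroup_iff'.1 hW, Algebra.algebraMap_eq_smul_one, NNReal.smul_def]
    ext i j
    simp only [Matrix.smul_apply, Complex.star_def, smul_eq_mul, ← Complex.normSq_eq_conj_mul_self]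
    simp [Complex.normSq_eq_norm_sq]
  open scoped MatrixOrder in
  rw [e, CFC.rpow_algebraMap, Algebra.algebraMap_eq_smul_one, NNReal.smul_def, Matrix.trace_smul,
    Matrix.trace_one, Fintype.card_fin]
  have e2 : ((((‖c‖₊ ^ 2) ^ (q / 2) : NNReal) : ℝ) • (k : ℂ)).re = k * ‖c‖ ^ q := by
    rw [Complex.smul_re, Complex.natCast_re, smul_eq_mul, mul_comm]
    congr 1
    push_cast
    rw [← Real.rpow_natCast, ← Real.rpow_mul (norm_nonneg _)]
    congr 1
    push_cast
    ring
  rw [e2, Real.mul_rpow (by positivity) (by positivity), ← Real.rpow_mul (norm_nonneg _),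
    mul_one_div_cancel hq.ne', Real.rpow_one]

end Norms

/-! ### Relations between 3-cycles sharing two points -/

section ThreeCycle

variable {α : Type*} [DecidableEq α]

/-- The cyclic permutation `a ↦ b ↦ c ↦ a`. -/
def cyclePerm (a b c : α) : Equiv.Perm α := Equiv.swap a b * Equiv.swap b c

theorem conj_cyclePerm (σ : Equiv.Perm α) (a b c : α) :
    σ * cyclePerm a b c * σ⁻¹ = cyclePerm (σ a) (σ b) (σ c) := by
  simp only [cyclePerm, Equiv.swap_apply_apply]
  group

theorem cyclePerm_inv (a b c : α) :
    (cyclePerm a b c)⁻¹ = Equiv.swap b c * Equiv.swap a b := by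
  simp [cyclePerm]

variable {a b c d : α}

theorem cyclePerm_pow_three (hab : a ≠ b) (hac : a ≠ c) (hbc : b ≠ c) :
    cyclePerm a b c ^ 3 = 1 := by
  ext x
  simp only [cyclePerm, pow_succ, pow_zero, one_mul, Equiv.Perm.mul_apply, Equiv.Perm.one_apply,
    Equiv.swap_apply_def]
  grind

/-- The product is the double transposition (a c)(b d). -/
theorem cyclePerm_mul_cyclePerm_sq (hab : a ≠ b) (hac : a ≠ c) (hbc : b ≠ c) (had : a ≠ d)
    (hbd : b ≠ d) (hcd : c ≠ d) : (cyclePerm a b c * cyclePerm a b d) ^ 2 = 1 := by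
  have h : cyclePerm a b c * cyclePerm a b d = Equiv.swap a c * Equiv.swap b d := by
    ext x
    simp only [cyclePerm, Equiv.Perm.mul_apply, Equiv.swap_apply_def]
    grind
  rw [h]
  ext x
  simp only [sq, Equiv.Perm.mul_apply, Equiv.Perm.one_apply, Equiv.swap_apply_def]
  grind

/-- The quotient is again a 3-cycle, (b d c). -/
theorem cyclePerm_inv_mul_cyclePerm_pow_three (hab : a ≠ b) (hac : a ≠ c) (hbc : b ≠ c)
    (had : a ≠ d) (hbd : b ≠ d) (hcd : c ≠ d) :
    ((cyclePerm a b c)⁻¹ * cyclePerm a b d) ^ 3 = 1 := by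
  have h : (cyclePerm a b c)⁻¹ * cyclePerm a b d = cyclePerm b d c := by
    rw [cyclePerm_inv]
    ext x
    simp only [cyclePerm, Equiv.Perm.mul_apply, Equiv.swap_apply_def]
    grind
  rw [h]
  exact cyclePerm_pow_three hbd hbc hcd.symm

end ThreeCycle

/-! ### Structure of `Γ ∨ Λ` and its homomorphisms to compact groups -/

section Vee

open scoped commutatorElement

variable {Γ Λ : Type*} [Group Γ] [Group Λ]

theorem VeeSet.inl_one : VeeSet.inl Γ Λ 1 = VeeSet.inr Γ Λ 1 := rfl

theorem VeeSet.inl_eq_inr_iff {x : Γ} {y : Λ} :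
    VeeSet.inl Γ Λ x = VeeSet.inr Γ Λ y ↔ x = 1 ∧ y = 1 := by
  constructor
  · intro h
    exact ⟨congrArg (fun s : VeeSet Γ Λ => s.1.1) h,
      (congrArg (fun s : VeeSet Γ Λ => s.1.2) h).symm⟩
  · rintro ⟨rfl, rfl⟩; rfl

theorem VeeSet.eq_inl_or_eq_inr (s : VeeSet Γ Λ) :
    (∃ x, s = VeeSet.inl Γ Λ x) ∨ ∃ y, y ≠ 1 ∧ s = VeeSet.inr Γ Λ y := by
  obtain ⟨⟨x, y⟩, h⟩ := s
  by_cases hy : y = 1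
  · exact Or.inl ⟨x, by subst hy; rfl⟩
  · refine Or.inr ⟨y, hy, ?_⟩
    obtain rfl : x = 1 := h.resolve_right hy
    rfl

theorem veeActionLeft_inl (γ x : Γ) :
    veeActionLeft Γ Λ γ (VeeSet.inl Γ Λ x) = VeeSet.inl Γ Λ (γ * x) :=
  Equiv.Perm.viaEmbedding_apply _ _ _

theorem veeActionRight_inr (l y : Λ) :
    veeActionRight Γ Λ l (VeeSet.inr Γ Λ y) = VeeSet.inr Γ Λ (l * y) :=
  Equiv.Perm.viaEmbedding_apply _ _ _

theorem veeActionLeft_inr (γ : Γ) {y : Λ} (hy : y ≠ 1) :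
    veeActionLeft Γ Λ γ (VeeSet.inr Γ Λ y) = VeeSet.inr Γ Λ y :=
  Equiv.Perm.viaEmbedding_apply_of_notMem _ _ _ (by
    rintro ⟨x, hx⟩
    exact hy (VeeSet.inl_eq_inr_iff.1 hx).2)

theorem veeActionRight_inl (l : Λ) {x : Γ} (hx : x ≠ 1) :
    veeActionRight Γ Λ l (VeeSet.inl Γ Λ x) = VeeSet.inl Γ Λ x :=
  Equiv.Perm.viaEmbedding_apply_of_notMem _ _ _ (by
    rintro ⟨y, hy⟩
    exact hx (VeeSet.inl_eq_inr_iff.1 hy.symm).1)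

-- The supports of the two permutations meet only in the common identity, so their commutator is a
-- 3-cycle.
open Classical in
theorem veeAction_commutator {γ : Γ} {l : Λ} (hγ : γ ≠ 1) (hl : l ≠ 1) :
    ⁅veeActionLeft Γ Λ γ, veeActionRight Γ Λ l⁆
      = cyclePerm (VeeSet.inl Γ Λ 1) (VeeSet.inl Γ Λ γ) (VeeSet.inr Γ Λ l) := by
  rw [commutatorElement_def, mul_inv_eq_iff_eq_mul, mul_inv_eq_iff_eq_mul]
  ext1 s
  simp only [Equiv.Perm.mul_apply, cyclePerm]
  have hinl : ∀ x y, VeeSet.inl Γ Λ x = VeeSet.inl Γ Λ y ↔ x = y :=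
    fun x y => (VeeSet.inl Γ Λ).injective.eq_iff
  have hinr : ∀ x y, VeeSet.inr Γ Λ x = VeeSet.inr Γ Λ y ↔ x = y :=
    fun x y => (VeeSet.inr Γ Λ).injective.eq_iff
  have hlr := fun x y => VeeSet.inl_eq_inr_iff (Γ := Γ) (Λ := Λ) (x := x) (y := y)
  have hrl : ∀ x y, VeeSet.inr Γ Λ y = VeeSet.inl Γ Λ x ↔ x = 1 ∧ y = 1 :=
    fun x y => by rw [eq_comm, hlr]
  rcases VeeSet.eq_inl_or_eq_inr s with ⟨x, rfl⟩ | ⟨y, hy, rfl⟩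
  · by_cases hx : x = 1
    · subst hx
      rw [VeeSet.inl_one, veeActionRight_inr, mul_one, veeActionLeft_inr _ hl, ← VeeSet.inl_one,
        veeActionLeft_inl, mul_one, veeActionRight_inl _ hγ]
      simp [Equiv.swap_apply_def, hrl, hγ, hl]
    · rw [veeActionRight_inl _ hx, veeActionLeft_inl]
      by_cases hgx : γ * x = 1
      · rw [hgx, VeeSet.inl_one, veeActionRight_inr, mul_one, ← VeeSet.inl_one]
        simp
      · rw [veeActionRight_inl _ hgx]
        simp [Equiv.swap_apply_def, hinl, hlr, hl, hx, hgx]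
  · rw [veeActionRight_inr, veeActionLeft_inr _ hy, veeActionRight_inr]
    by_cases hly : l * y = 1
    · rw [hly, ← VeeSet.inl_one, veeActionLeft_inl]
      simp [Equiv.swap_apply_def, hinl, hlr, hγ.symm, hl]
    · rw [veeActionLeft_inr _ hly]
      simp [Equiv.swap_apply_def, hrl, hinr, hγ, hy, hly]

/-- The element of `Γ ∨ Λ` given by an element of `Γ`. -/
noncomputable def veeLeft (Γ Λ : Type*) [Group Γ] [Group Λ] : Γ →* veeGroup Γ Λ :=
  (veeActionLeft Γ Λ).codRestrict _ fun γ => Subgroup.mem_sup_left ⟨γ, rfl⟩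

/-- The element of `Γ ∨ Λ` given by an element of `Λ`. -/
noncomputable def veeRight (Γ Λ : Type*) [Group Γ] [Group Λ] : Λ →* veeGroup Γ Λ :=
  (veeActionRight Γ Λ).codRestrict _ fun l => Subgroup.mem_sup_right ⟨l, rfl⟩

/-- In a compact group without small elements of order three, the images of `Γ` and `Λ` under a
homomorphism from `Γ ∨ Λ` commute at elements of large order. -/
theorem commute_map_veeLeft_veeRight {K : Type*} [Group K] [TopologicalSpace K]
    [IsTopologicalGroup K] [CompactSpace K] (hK : ∀ᶠ x : K in 𝓝 1, x ^ 3 = 1 → x = 1)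
    (ψ : veeGroup Γ Λ →* K) {γ : Γ} {l : Λ} (hγ : γ ≠ 1) (hγ2 : γ * γ ≠ 1)
    (hl : ∀ m : ℕ, m ≠ 0 → l ^ m ≠ 1) : Commute (ψ (veeLeft Γ Λ γ)) (ψ (veeRight Γ Λ l)) := by
  classical
  have hl1 : l ≠ 1 := by simpa using hl 1 one_ne_zero
  set g := veeLeft Γ Λ γ
  set r := veeRight Γ Λ l
  -- Conjugation by γ moves the cycle off the base point: γ and γ² are fixed by Λ, so conjugating P
  -- by powers of r moves only its third point.
  set P : veeGroup Γ Λ := g * ⁅g, r⁆ * g⁻¹ with hP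
  have hP1 : (P : Equiv.Perm (VeeSet Γ Λ))
      = cyclePerm (VeeSet.inl Γ Λ γ) (VeeSet.inl Γ Λ (γ * γ)) (VeeSet.inr Γ Λ l) := by
    change veeActionLeft Γ Λ γ * ⁅veeActionLeft Γ Λ γ, veeActionRight Γ Λ l⁆ *
      (veeActionLeft Γ Λ γ)⁻¹ = _
    rw [veeAction_commutator hγ hl1, conj_cyclePerm, veeActionLeft_inl, veeActionLeft_inl,
      veeActionLeft_inr _ hl1, mul_one]
  have hR : ∀ m : ℕ, ((r ^ m * P * (r ^ m)⁻¹ : veeGroup Γ Λ) : Equiv.Perm (VeeSet Γ Λ))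
      = cyclePerm (VeeSet.inl Γ Λ γ) (VeeSet.inl Γ Λ (γ * γ)) (VeeSet.inr Γ Λ (l ^ (m + 1))) := by
    intro m
    have : ((r ^ m : veeGroup Γ Λ) : Equiv.Perm (VeeSet Γ Λ)) = veeActionRight Γ Λ (l ^ m) := by
      rw [map_pow]; rfl
    rw [Subgroup.coe_mul, Subgroup.coe_mul, Subgroup.coe_inv, this, hP1, conj_cyclePerm,
      veeActionRight_inl _ hγ, veeActionRight_inl _ hγ2, veeActionRight_inr, pow_succ]
  have hab : VeeSet.inl Γ Λ γ ≠ VeeSet.inl Γ Λ (γ * γ) :=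
    (VeeSet.inl Γ Λ).injective.ne (by simpa using hγ)
  have hac : ∀ y, VeeSet.inl Γ Λ γ ≠ VeeSet.inr Γ Λ y := fun y h =>
    hγ (VeeSet.inl_eq_inr_iff.1 h).1
  have hbc : ∀ y, VeeSet.inl Γ Λ (γ * γ) ≠ VeeSet.inr Γ Λ y := fun y h =>
    hγ2 (VeeSet.inl_eq_inr_iff.1 h).1
  have hcd : ∀ m : ℕ, 1 ≤ m → VeeSet.inr Γ Λ l ≠ VeeSet.inr Γ Λ (l ^ (m + 1)) := fun m hm =>
    (VeeSet.inr Γ Λ).injective.ne (by simpa [pow_succ] using (hl m (by omega)))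
  have h1 : P ^ 3 = 1 := Subtype.ext (by
    rw [SubmonoidClass.coe_pow, hP1]; exact cyclePerm_pow_three hab (hac _) (hbc _))
  have h2 : ∀ m : ℕ, 1 ≤ m → (P * (r ^ m * P * (r ^ m)⁻¹)) ^ 2 = 1 := fun m hm =>
    Subtype.ext (by
      rw [SubmonoidClass.coe_pow, Subgroup.coe_mul, hR, hP1]
      exact cyclePerm_mul_cyclePerm_sq hab (hac _) (hbc _) (hac _) (hbc _) (hcd m hm))
  have h3 : ∀ m : ℕ, 1 ≤ m → (P⁻¹ * (r ^ m * P * (r ^ m)⁻¹)) ^ 3 = 1 := fun m hm =>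
    Subtype.ext (by
      rw [SubmonoidClass.coe_pow, Subgroup.coe_mul, Subgroup.coe_inv, hR, hP1]
      exact cyclePerm_inv_mul_cyclePerm_pow_three hab (hac _) (hbc _) (hac _) (hbc _) (hcd m hm))
  have hf : Tendsto (fun x : K => (ψ P)⁻¹ * (x * ψ P * x⁻¹)) (𝓝 1) (𝓝 1) := by
    have : Continuous fun x : K => (ψ P)⁻¹ * (x * ψ P * x⁻¹) := by fun_prop
    simpa using this.tendsto 1
  -- Recurrence in the compact group: some ψ(r)^m is so close to 1 that ψ(P)⁻¹ times the conjugate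
  -- of ψ(P) by it, whose cube is 1, must be trivial.
  obtain ⟨m, hm, hm1⟩ := (((mapClusterPt_one_atTop_pow (ψ r)).frequently
    (hf.eventually hK)).and_eventually (eventually_ge_atTop 1)).exists
  have h4 : (ψ P)⁻¹ * (ψ r ^ m * ψ P * (ψ r ^ m)⁻¹) = 1 := by
    apply hm
    simpa using congrArg ψ (h3 m hm1)
  have h5 : ψ r ^ m * ψ P * (ψ r ^ m)⁻¹ = ψ P := (inv_mul_eq_one.1 h4).symm
  -- Both 3-cycles now have the same image, so the double transposition relation reads ψ(P)⁴ = 1,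
  -- while ψ(P)³ = 1.
  have h6 : (ψ P * ψ P) ^ 2 = 1 := by
    have := congrArg ψ (h2 m hm1)
    simpa [h5] using this
  have h7 : ψ P ^ 3 = 1 := by rw [← map_pow, h1, map_one]
  have h8 : ψ P = 1 := by
    calc ψ P = ψ P ^ 3 * ψ P := by rw [h7, one_mul]
      _ = (ψ P * ψ P) ^ 2 := by rw [← pow_succ, ← sq, ← pow_mul]
      _ = 1 := h6
  rw [hP, map_mul, map_mul, map_inv, mul_inv_eq_one, mul_eq_left, map_commutatorElement,
    commutatorElement_eq_one_iff_commute] at h8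
  exact h8

/-- Permutations of `Γ ∪ Λ` agreeing outside a finite set with a translation of `Γ` and with a
translation of `Λ`, together with these translations. -/
def veeGermSubgroup (Γ Λ : Type*) [Group Γ] [Group Λ] :
    Subgroup (Equiv.Perm (VeeSet Γ Λ) × Γ × Λ) where
  carrier := {t | (∀ᶠ x in cofinite, t.1 (VeeSet.inl Γ Λ x) = VeeSet.inl Γ Λ (t.2.1 * x)) ∧
    ∀ᶠ y in cofinite, t.1 (VeeSet.inr Γ Λ y) = VeeSet.inr Γ Λ (t.2.2 * y)}
  one_mem' := by simp
  mul_mem' := by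
    rintro ⟨σ, γ, l⟩ ⟨τ, δ, k⟩ ⟨h1, h2⟩ ⟨h3, h4⟩
    constructor
    · filter_upwards [h3, (mul_right_injective δ).tendsto_cofinite.eventually h1] with x hx hx'
      simp_all [mul_assoc]
    · filter_upwards [h4, (mul_right_injective k).tendsto_cofinite.eventually h2] with x hx hx'
      simp_all [mul_assoc]
  inv_mem' := by
    rintro ⟨σ, γ, l⟩ ⟨h1, h2⟩
    constructor
    · filter_upwards [(mul_right_injective γ⁻¹).tendsto_cofinite.eventually h1] with x hx
      simp_all [Equiv.symm_apply_eq]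
    · filter_upwards [(mul_right_injective l⁻¹).tendsto_cofinite.eventually h2] with x hx
      simp_all [Equiv.symm_apply_eq]

/-- On an infinite group cofinite sets meet, and one point of agreement determines a translation. -/
theorem veeGermSubgroup_unique [Infinite Γ] [Infinite Λ] {σ : Equiv.Perm (VeeSet Γ Λ)}
    {s t : Γ × Λ} (hs : (σ, s) ∈ veeGermSubgroup Γ Λ) (ht : (σ, t) ∈ veeGermSubgroup Γ Λ) :
    s = t := by
  obtain ⟨x, hx, hx'⟩ := (hs.1.and ht.1).exists
  obtain ⟨y, hy, hy'⟩ := (hs.2.and ht.2).exists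
  exact Prod.ext (mul_right_cancel ((VeeSet.inl Γ Λ).injective (hx.symm.trans hx')))
    (mul_right_cancel ((VeeSet.inr Γ Λ).injective (hy.symm.trans hy')))

theorem veeActionLeft_mem_veeGermSubgroup (γ : Γ) :
    (veeActionLeft Γ Λ γ, γ, 1) ∈ veeGermSubgroup Γ Λ :=
  ⟨.of_forall fun x => veeActionLeft_inl γ x, by
    filter_upwards [eventually_cofinite_ne (1 : Λ)] with y hy
    simpa using veeActionLeft_inr γ hy⟩

theorem veeActionRight_mem_veeGermSubgroup (l : Λ) :
    (veeActionRight Γ Λ l, 1, l) ∈ veeGermSubgroup Γ Λ :=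
  ⟨by
    filter_upwards [eventually_cofinite_ne (1 : Γ)] with y hy
    simpa using veeActionRight_inl l hy, .of_forall fun x => veeActionRight_inr l x⟩

/-- `Γ × Λ` is a quotient of `Γ ∨ Λ` if both groups are infinite. -/
theorem exists_veeGroup_hom_prod [Infinite Γ] [Infinite Λ] :
    ∃ f : veeGroup Γ Λ →* Γ × Λ, (∀ γ, f (veeLeft Γ Λ γ) = (γ, 1)) ∧
      ∀ l, f (veeRight Γ Λ l) = (1, l) := by
  have hex : ∀ σ : veeGroup Γ Λ, ∃ t : Γ × Λ, ((σ : Equiv.Perm (VeeSet Γ Λ)), t) ∈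
      veeGermSubgroup Γ Λ := by
    have hle : veeGroup Γ Λ ≤ (veeGermSubgroup Γ Λ).map (MonoidHom.fst _ _) := by
      refine sup_le ?_ ?_
      · rintro _ ⟨γ, rfl⟩
        exact ⟨_, veeActionLeft_mem_veeGermSubgroup γ, rfl⟩
      · rintro _ ⟨γ, rfl⟩
        exact ⟨_, veeActionRight_mem_veeGermSubgroup γ, rfl⟩
    intro σ
    obtain ⟨⟨τ, t⟩, ht, hτ⟩ := hle σ.2
    exact ⟨t, by rw [← hτ]; exact ht⟩
  choose f hf using hex
  exact ⟨MonoidHom.mk' f fun σ τ => veeGermSubgroup_unique (hf _) (mul_mem (hf σ) (hf τ)),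
    fun γ => veeGermSubgroup_unique (hf _) (veeActionLeft_mem_veeGermSubgroup γ),
    fun l => veeGermSubgroup_unique (hf _) (veeActionRight_mem_veeGermSubgroup l)⟩

end Vee

/-! ### The Exel–Loring winding number obstruction -/

section ExelLoring

open scoped Matrix.Norms.L2Operator

theorem norm_mul_sub_mul_le {A : Type*} [NormedRing A] {a b a' b' : A} (hb : ‖b‖ ≤ 1)
    (ha' : ‖a'‖ ≤ 1) (h : ‖a - a'‖ ≤ 1 / 20) (h' : ‖b - b'‖ ≤ 1 / 20) :
    ‖a * b - a' * b'‖ ≤ 1 / 5 := by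
  have e : a * b - a' * b' = (a - a') * b + a' * (b - b') := by noncomm_ring
  rw [e]
  refine (norm_add_le _ _).trans ?_
  have h1 := (norm_mul_le (a - a') b).trans (mul_le_mul h hb (norm_nonneg _) (by norm_num))
  have h2 := (norm_mul_le a' (b - b')).trans (mul_le_mul ha' h' (norm_nonneg _) (by norm_num))
  linarith

/-- The retraction of the real line onto the unit interval. -/
def clampUnit (t : ℝ) : ℝ := max 0 (min 1 t)

theorem continuous_clampUnit : Continuous clampUnit := by unfold clampUnit; fun_prop

theorem clampUnit_nonneg (t : ℝ) : 0 ≤ clampUnit t := le_max_left _ _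

theorem clampUnit_le_one (t : ℝ) : clampUnit t ≤ 1 :=
  max_le zero_le_one (min_le_left _ _)

@[simp] theorem clampUnit_zero : clampUnit 0 = 0 := by simp [clampUnit]

@[simp] theorem clampUnit_one : clampUnit 1 = 1 := by simp [clampUnit]

theorem norm_lineMap_le {E : Type*} [NormedAddCommGroup E] [NormedSpace ℂ E] {a b : E} {R : ℝ}
    (ha : ‖a‖ ≤ R) (hb : ‖b‖ ≤ R) (t : ℝ) :
    ‖((1 - clampUnit t : ℝ) : ℂ) • a + (clampUnit t : ℂ) • b‖ ≤ R := by
  have h0 := clampUnit_nonneg t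
  have h1 := clampUnit_le_one t
  refine (norm_add_le _ _).trans ?_
  rw [norm_smul, norm_smul, Complex.norm_of_nonneg h0, Complex.norm_of_nonneg (by linarith)]
  nlinarith

variable {n : Type*} [Fintype n] [DecidableEq n]

/-- Unitary matrices commuting up to a scalar near, but different from, one are not close to
commuting unitary matrices. -/
theorem eq_one_of_near_commuting [Nonempty n] {u v X Y : Matrix n n ℂ}
    (hu : u ∈ Matrix.unitaryGroup n ℂ) (hv : v ∈ Matrix.unitaryGroup n ℂ)
    (hX : X ∈ Matrix.unitaryGroup n ℂ) (hY : Y ∈ Matrix.unitaryGroup n ℂ) {z : ℂ}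
    (hvu : v * u = z • (u * v)) (hz : ‖z - 1‖ ≤ 1 / 10) (hXY : Commute X Y)
    (hXu : ‖X - u‖ ≤ 1 / 20) (hYv : ‖Y - v‖ ≤ 1 / 20) : z = 1 := by
  -- Straight segments from (u, v) to (X, Y), then from UV to VU. They leave the unitaries, but only
  -- invertibility of M is needed. Clamping extends everything to the plane, where lifts exist.
  set U : ℝ → Matrix n n ℂ := fun s =>
    ((1 - clampUnit s : ℝ) : ℂ) • u + (clampUnit s : ℂ) • X with hU
  set V : ℝ → Matrix n n ℂ := fun s =>
    ((1 - clampUnit s : ℝ) : ℂ) • v + (clampUnit s : ℂ) • Y with hV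
  set M : ℝ × ℝ → Matrix n n ℂ := fun x =>
    ((1 - clampUnit x.2 : ℝ) : ℂ) • (U x.1 * V x.1) + (clampUnit x.2 : ℂ) • (V x.1 * U x.1) with hM
  have hc := continuous_clampUnit
  have hUc : Continuous U := by fun_prop
  have hVc : Continuous V := by fun_prop
  have hMc : Continuous M := by fun_prop
  have hu1 := norm_le_one_of_mem_unitaryGroup hu
  have hv1 := norm_le_one_of_mem_unitaryGroup hv
  have hU1 : ∀ s, ‖U s‖ ≤ 1 := norm_lineMap_le hu1 (norm_le_one_of_mem_unitaryGroup hX)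
  have hV1 : ∀ s, ‖V s‖ ≤ 1 := norm_lineMap_le hv1 (norm_le_one_of_mem_unitaryGroup hY)
  have hsub : ∀ (a b c : Matrix n n ℂ) (t : ℝ),
      ((1 - clampUnit t : ℝ) : ℂ) • a + (clampUnit t : ℂ) • b - c
        = ((1 - clampUnit t : ℝ) : ℂ) • (a - c) + (clampUnit t : ℂ) • (b - c) := by
    intro a b c t
    push_cast
    module
  have hUu : ∀ s, ‖U s - u‖ ≤ 1 / 20 := fun s => by
    rw [hU]; simp only; rw [hsub]
    exact norm_lineMap_le (by simp) hXu s
  have hVv : ∀ s, ‖V s - v‖ ≤ 1 / 20 := fun s => by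
    rw [hV]; simp only; rw [hsub]
    exact norm_lineMap_le (by simp) hYv s
  -- The bound is 1/5 for the product estimate plus 1/10 for z; being below 1, it keeps M
  -- invertible.
  have hMuv : ∀ x, ‖M x - u * v‖ ≤ 3 / 10 := fun x => by
    rw [hM]; simp only; rw [hsub]
    refine norm_lineMap_le ?_ ?_ _
    · exact (norm_mul_sub_mul_le (hV1 _) hu1 (hUu _) (hVv _)).trans (by norm_num)
    · have e : V x.1 * U x.1 - u * v = (V x.1 * U x.1 - v * u) + (z - 1) • (u * v) := by
        rw [hvu, sub_smul, one_smul]; abel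
      rw [e]
      refine (norm_add_le _ _).trans ?_
      have h1 := norm_mul_sub_mul_le (hU1 x.1) hv1 (hVv x.1) (hUu x.1)
      have h2 : ‖(z - 1) • (u * v)‖ ≤ 1 / 10 := by
        rw [norm_smul]
        have h3 := norm_le_one_of_mem_unitaryGroup (mul_mem hu hv)
        nlinarith [norm_nonneg (z - 1)]
      linarith
  have hF0 : ∀ x, (M x).det ≠ 0 := fun x =>
    Matrix.det_ne_zero_of_norm_sub_unitary_lt_one (mul_mem hu hv)
      ((hMuv x).trans_lt (by norm_num))
  have hU0 : U 0 = u := by simp [hU]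
  have hV0 : V 0 = v := by simp [hV]
  have hU1' : U 1 = X := by simp [hU]
  have hV1' : V 1 = Y := by simp [hV]
  have hdet : (u * v).det ≠ 0 := by simpa [hM, hU0, hV0] using hF0 (0, 0)
  -- Over (u, v) the determinant is det(uv)(1 + r(z - 1))^k with k the matrix size, and the
  -- principal logarithm of the base is continuous in r.
  have hsl : ∀ r, 1 + (clampUnit r : ℂ) * (z - 1) ∈ Complex.slitPlane := fun r => by
    refine Complex.mem_slitPlane_of_norm_lt_one ?_
    rw [norm_mul, Complex.norm_of_nonneg (clampUnit_nonneg r)]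
    nlinarith [clampUnit_nonneg r, clampUnit_le_one r, norm_nonneg (z - 1)]
  have key := log_increment_eq_of_homotopy (F := fun x => (M x).det)
    (l₀ := fun r => Complex.log (u * v).det
      + (Fintype.card n : ℂ) * Complex.log (1 + (clampUnit r : ℂ) * (z - 1)))
    (l₁ := fun _ => Complex.log (M (1, 0)).det) hMc.matrix_det hF0
    (fun s => by
      simp only [hM, clampUnit_zero, clampUnit_one, sub_zero, sub_self, Complex.ofReal_one,
        Complex.ofReal_zero, one_smul, zero_smul, add_zero, zero_add]
      rw [Matrix.det_mul_comm])
    (continuous_const.add (continuous_const.mul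
      (Continuous.clog (by fun_prop) hsl)))
    continuous_const
    (fun r => by
      have e : M (0, r) = (1 + (clampUnit r : ℂ) * (z - 1)) • (u * v) := by
        simp only [hM, hU0, hV0, hvu]
        push_cast
        module
      rw [e, Matrix.det_smul, Complex.exp_add, Complex.exp_log hdet, Complex.exp_nat_mul,
        Complex.exp_log (Complex.slitPlane_ne_zero (hsl r)), mul_comm])
    (fun r => by
      rw [Complex.exp_log (hF0 _)]
      congr 1
      simp only [hM, hU1', hV1', hXY.eq]
      push_cast
      module)
  -- At the commuting end the loop is constant, so the matrix size times log z vanishes.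
  simp only [clampUnit_one, clampUnit_zero, Complex.ofReal_one, Complex.ofReal_zero, one_mul,
    zero_mul, add_zero, Complex.log_one, mul_zero, sub_self, add_sub_cancel,
    add_sub_cancel_left, mul_eq_zero, Nat.cast_eq_zero, Fintype.card_ne_zero, false_or] at key
  have hz0 : z ≠ 0 := by
    rintro rfl
    norm_num at hz
  rw [← Complex.exp_log hz0, key, Complex.exp_zero]

end ExelLoring

/-! ### Voiculescu's unitaries and their powers -/

section Voiculescu

variable {n : Type*} [Fintype n] [DecidableEq n]

/-- Scalar unitary matrices. -/
def scalarUnitary (n : Type*) [Fintype n] [DecidableEq n] :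
    Circle →* Matrix.unitaryGroup n ℂ where
  toFun z := ⟨(z : ℂ) • 1, by
    rw [Matrix.mem_unitaryGroup_iff, star_smul, smul_mul_smul_comm, star_one, one_mul]
    simp [Complex.mul_conj]⟩
  map_one' := Subtype.ext (by simp)
  map_mul' a b := Subtype.ext (by
    change ((a : ℂ) * (b : ℂ)) • (1 : Matrix n n ℂ) = ((a : ℂ) • 1) * ((b : ℂ) • 1)
    rw [smul_mul_smul_comm, one_mul])

theorem coe_scalarUnitary_mul (z : Circle) (W : Matrix.unitaryGroup n ℂ) :
    ((scalarUnitary n z * W : Matrix.unitaryGroup n ℂ) : Matrix n n ℂ)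
      = (z : ℂ) • (W : Matrix n n ℂ) := by
  change ((z : ℂ) • (1 : Matrix n n ℂ)) * (W : Matrix n n ℂ) = _
  rw [smul_mul_assoc, one_mul]

theorem commute_scalarUnitary (z : Circle) (W : Matrix.unitaryGroup n ℂ) :
    Commute (scalarUnitary n z) W := by
  refine Subtype.ext ?_
  rw [coe_scalarUnitary_mul]
  change _ = (W : Matrix n n ℂ) * ((z : ℂ) • (1 : Matrix n n ℂ))
  rw [mul_smul_comm, mul_one]

/-- Voiculescu's unitary matrices. -/
theorem exists_voiculescu_unitaries (N : ℕ) : ∃ u v : Matrix.unitaryGroup (Fin (N + 1)) ℂ,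
    v * u = scalarUnitary _ (Circle.exp (2 * Real.pi / (N + 1))) * (u * v) := by
  set ω : Circle := Circle.exp (2 * Real.pi / (N + 1)) with hω
  have hωN : ω ^ (N + 1) = 1 := by
    rw [hω, ← Circle.exp_nsmul, Circle.exp_eq_one]
    refine ⟨1, ?_⟩
    rw [nsmul_eq_mul]
    push_cast
    field_simp
  let τ : Equiv.Perm (Fin (N + 1)) := Equiv.addRight 1
  have hτ : ∀ i j, τ.permMatrix ℂ i j = if τ i = j then 1 else 0 := fun i j => by
    simp [Equiv.Perm.permMatrix, PEquiv.toMatrix_apply, eq_comm]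
  have hs : τ.permMatrix ℂ ∈ Matrix.unitaryGroup (Fin (N + 1)) ℂ := by
    rw [Matrix.mem_unitaryGroup_iff, Matrix.star_eq_conjTranspose, Matrix.conjTranspose_permMatrix,
      ← Matrix.permMatrix_mul, inv_mul_cancel, Matrix.permMatrix_one]
  have hd : Matrix.diagonal (fun j : Fin (N + 1) => ((ω ^ (j : ℕ) : Circle) : ℂ)) ∈
      Matrix.unitaryGroup (Fin (N + 1)) ℂ := by
    rw [Matrix.mem_unitaryGroup_iff, Matrix.star_eq_conjTranspose, Matrix.diagonal_conjTranspose,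
      Matrix.diagonal_mul_diagonal, ← Matrix.diagonal_one]
    congr 1
    funext j
    rw [Pi.star_apply, Complex.star_def, Complex.mul_conj, Circle.normSq_coe, Complex.ofReal_one]
  refine ⟨⟨_, hd⟩, ⟨_, hs⟩, Subtype.ext ?_⟩
  rw [coe_scalarUnitary_mul]
  change τ.permMatrix ℂ * Matrix.diagonal _ = _ • (Matrix.diagonal _ * τ.permMatrix ℂ)
  ext i j
  rw [Matrix.mul_diagonal, Matrix.smul_apply, Matrix.diagonal_mul, hτ]
  by_cases hij : τ i = j
  · subst hij
    -- The wrap-around of the cyclic shift is absorbed by ω^(N+1) = 1.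
    have : ω ^ ((τ i : Fin (N + 1)) : ℕ) = ω * ω ^ (i : ℕ) := by
      change ω ^ ((i + 1 : Fin (N + 1)) : ℕ) = _
      rw [Fin.val_add, ← pow_eq_pow_mod _ hωN, pow_add, Fin.val_one', ← pow_eq_pow_mod _ hωN, pow_one,
        mul_comm]
    rw [this]
    simp
  · simp [hij]

/-- Conjugation by v scales u, hence u^a by z^a; so conjugation by u^(-a) scales v by z^a, hence v^b
by z^(ab). -/
theorem zpow_mul_zpow_of_central {K : Type*} [Group K] {u v z : K} (hz : ∀ x, Commute z x)
    (h : v * u = z * (u * v)) (a b : ℤ) : v ^ b * u ^ a = z ^ (a * b) * (u ^ a * v ^ b) := by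
  have h1 : v * u * v⁻¹ = z * u := by rw [h]; group
  have h2 : v * u ^ a * v⁻¹ = z ^ a * u ^ a := by rw [← conj_zpow, h1, (hz u).mul_zpow]
  have h3 : (u ^ a)⁻¹ * v * u ^ a = z ^ a * v := by
    have : v * u ^ a = z ^ a * u ^ a * v := by rw [← h2]; group
    rw [mul_assoc, this, ((hz (u ^ a)).zpow_left a).eq]
    group
  have h4 : (u ^ a)⁻¹ * v ^ b * u ^ a = z ^ (a * b) * v ^ b := by
    have := conj_zpow (i := b) (a := (u ^ a)⁻¹) (b := v)
    rw [inv_inv] at this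
    rw [← this, h3, ((hz v).zpow_left a).mul_zpow, ← zpow_mul]
  have h5 : v ^ b * u ^ a = u ^ a * ((u ^ a)⁻¹ * v ^ b * u ^ a) := by group
  rw [h5, h4, ← mul_assoc, ← ((hz (u ^ a)).zpow_left _).eq, mul_assoc]

end Voiculescu

/-! ### The asymptotic homomorphism and the contradiction -/

section Main

theorem norm_coe_circle_exp_sub_one_le (t : ℝ) : ‖(Circle.exp t : ℂ) - 1‖ ≤ |t| := by
  rw [Circle.coe_exp, mul_comm]
  exact Real.norm_exp_I_mul_ofReal_sub_one_le

theorem exists_integerH1_apply_ne_zero {Γ : Type*} [Group Γ] (h : Nontrivial (IntegerH1 Γ)) :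
    ∃ (a : Γ →* Multiplicative ℤ) (γ : Γ), (a γ).toAdd ≠ 0 := by
  obtain ⟨f, hf⟩ := exists_ne (0 : IntegerH1 Γ)
  obtain ⟨x, hx⟩ := DFunLike.ne_iff.1 hf
  exact ⟨AddMonoidHom.toMultiplicativeRight f, x.toMul, hx⟩

theorem zpow_ne_one_of_toAdd_ne_zero {Γ : Type*} [Group Γ] {a : Γ →* Multiplicative ℤ} {γ : Γ}
    (h : (a γ).toAdd ≠ 0) {m : ℤ} (hm : m ≠ 0) : γ ^ m ≠ 1 := by
  intro he
  have := congrArg (fun x => (a x).toAdd) he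
  simp [hm, h] at this

theorem infinite_of_toAdd_ne_zero {Γ : Type*} [Group Γ] {a : Γ →* Multiplicative ℤ} {γ : Γ}
    (h : (a γ).toAdd ≠ 0) : Infinite Γ := by
  refine Infinite.of_injective (fun m : ℤ => γ ^ m) fun m m' hm => ?_
  by_contra hne
  refine zpow_ne_one_of_toAdd_ne_zero h (sub_ne_zero.2 hne) ?_
  rw [zpow_sub]
  exact mul_inv_eq_one.2 hm

/-- The total exponent 1/p - 1 is negative exactly because p > 1; for p = ∞ it is -1. -/
theorem tendsto_rpow_mul_div_succ {p : ℝ≥0∞} (hp : 1 < p) (C : ℝ) :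
    Tendsto (fun n : ℕ => (((n + 1 : ℕ) : ℝ)) ^ (1 / p.toReal) * (C / ((n : ℝ) + 1))) atTop
      (𝓝 0) := by
  have hs : 0 < 1 - 1 / p.toReal := by
    rw [sub_pos]
    by_cases h : p = ∞
    · simp [h]
    · have : 1 < p.toReal := by
        simpa using (ENNReal.toReal_lt_toReal ENNReal.one_ne_top h).2 hp
      rw [div_lt_one (by linarith)]
      exact this
  have h1 := ((tendsto_rpow_neg_atTop hs).comp
    ((tendsto_add_atTop_iff_nat 1).2 (tendsto_natCast_atTop_atTop (R := ℝ)))).const_mul C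
  rw [mul_zero] at h1
  refine h1.congr fun n => ?_
  have hn : (0 : ℝ) < ((n + 1 : ℕ) : ℝ) := by positivity
  simp only [Function.comp_apply]
  rw [neg_sub, Real.rpow_sub hn, Real.rpow_one]
  push_cast
  ring

open scoped Matrix.Norms.L2Operator in
/-- Pairs of unitary matrices commuting up to a scalar close to one give asymptotic homomorphisms
from groups mapping to `ℤ × ℤ`. -/
theorem isAsymptoticHom_zpow_mul_zpow {p : ℝ≥0∞} (hp : 1 < p) {G : Type*} [Group G]
    (a b : G →* Multiplicative ℤ) (u v : ∀ n : ℕ, Matrix.unitaryGroup (Fin (n + 1)) ℂ)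
    (huv : ∀ n, v n * u n = scalarUnitary _ (Circle.exp (2 * Real.pi / (n + 1))) * (u n * v n)) :
    IsAsymptoticHom p (fun n g => u n ^ (a g).toAdd * v n ^ (b g).toAdd) := by
  intro g h
  set m : ℤ := (a h).toAdd * (b g).toAdd with hm
  refine squeeze_zero (g := fun n : ℕ => (((n + 1 : ℕ) : ℝ)) ^ (1 / p.toReal) *
    ((|(m : ℝ)| * (2 * Real.pi)) / ((n : ℝ) + 1))) (fun n => ?_) (fun n => ?_)
    (tendsto_rpow_mul_div_succ hp _)
  · exact (norm_nonneg _).trans (norm_le_schattenNorm (zero_lt_one.trans hp).ne' _)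
  · set W := u n ^ (a (g * h)).toAdd * v n ^ (b (g * h)).toAdd with hW
    have hab : ∀ c : G →* Multiplicative ℤ, (c (g * h)).toAdd = (c g).toAdd + (c h).toAdd :=
      fun c => by rw [map_mul, toAdd_mul]
    -- Moving v^b(g) past u^a(h) costs the m-th power of the central scalar.
    have e : (u n ^ (a g).toAdd * v n ^ (b g).toAdd) * (u n ^ (a h).toAdd * v n ^ (b h).toAdd)
        = scalarUnitary _ (Circle.exp (m * (2 * Real.pi / (n + 1)))) * W := by
      have hc := commute_scalarUnitary (n := Fin (n + 1)) (Circle.exp (2 * Real.pi / (n + 1)))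
      rw [← zsmul_eq_mul, Circle.exp_zsmul, map_zpow, hW, hab, hab,
        zpow_add, zpow_add, mul_assoc, ← mul_assoc (v n ^ _) (u n ^ _),
        zpow_mul_zpow_of_central hc (huv n), ← hm, mul_assoc (_ ^ m), ← mul_assoc,
        ← ((hc (u n ^ (a g).toAdd)).zpow_left m).eq]
      simp only [mul_assoc]
    have e' : (W : Matrix (Fin (n + 1)) (Fin (n + 1)) ℂ) -
        ((u n ^ (a g).toAdd * v n ^ (b g).toAdd) *
          (u n ^ (a h).toAdd * v n ^ (b h).toAdd)).1
        = (1 - (Circle.exp (m * (2 * Real.pi / (n + 1))) : ℂ)) •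
          (W : Matrix (Fin (n + 1)) (Fin (n + 1)) ℂ) := by
      rw [e, coe_scalarUnitary_mul, sub_smul, one_smul]
    refine (congrArg (schattenNorm p) e').le.trans ?_
    refine (schattenNorm_smul_unitary_le (zero_lt_one.trans hp).ne' _ W.2).trans ?_
    gcongr
    rw [norm_sub_rev]
    refine (norm_coe_circle_exp_sub_one_le _).trans (le_of_eq ?_)
    rw [abs_mul, abs_of_nonneg (by positivity : 0 ≤ 2 * Real.pi / ((n : ℝ) + 1))]
    ring

open scoped Matrix.Norms.L2Operator in
theorem mainTheorem5 {Γ : Type*} {Λ : Type*} [Group Γ] [Group Λ] [Group.FG Γ] [Group.FG Λ]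
    (hΓ : Nontrivial (IntegerH1 Γ)) (hΛ : Nontrivial (IntegerH1 Λ))
    (p : ℝ≥0∞) (hp : 1 < p) :
    ¬ IsSchattenStable p (veeGroup Γ Λ) := by
  intro hst
  obtain ⟨a, γ, hγ⟩ := exists_integerH1_apply_ne_zero hΓ
  obtain ⟨b, l, hl⟩ := exists_integerH1_apply_ne_zero hΛ
  have : Infinite Γ := infinite_of_toAdd_ne_zero hγ
  have : Infinite Λ := infinite_of_toAdd_ne_zero hl
  obtain ⟨f, hfl, hfr⟩ := exists_veeGroup_hom_prod (Γ := Γ) (Λ := Λ)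
  choose u v huv using exists_voiculescu_unitaries
  have hp0 : p ≠ 0 := (zero_lt_one.trans hp).ne'
  obtain ⟨ψ, hψ⟩ := hst (fun n => n + 1) (fun n => n.succ_pos) _
    (isAsymptoticHom_zpow_mul_zpow hp (a.comp ((MonoidHom.fst _ _).comp f))
      (b.comp ((MonoidHom.snd _ _).comp f)) u v huv)
  set d : ℤ := (a γ).toAdd with hd
  set e : ℤ := (b l).toAdd with he
  have hX := (hψ (veeLeft Γ Λ γ)).eventually_lt_const (u := 1 / 20) (by norm_num)
  have hY := (hψ (veeRight Γ Λ l)).eventually_lt_const (u := 1 / 20) (by norm_num)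
  simp only [MonoidHom.comp_apply, MonoidHom.coe_fst, MonoidHom.coe_snd, hfl, hfr, map_one,
    toAdd_one, zpow_zero, mul_one, one_mul, ← hd, ← he] at hX hY
  have hz : Tendsto (fun n : ℕ => |((d * e : ℤ) : ℝ)| * (2 * Real.pi) * (1 / ((n : ℝ) + 1)))
      atTop (𝓝 0) := by
    simpa using (tendsto_one_div_add_atTop_nhds_zero_nat (𝕜 := ℝ)).const_mul
      (|((d * e : ℤ) : ℝ)| * (2 * Real.pi))
  obtain ⟨n, hXn, hYn, hzn⟩ := (hX.and (hY.and
    (hz.eventually_lt_const (u := 1 / 10) (by norm_num)))).exists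
  have hcomm := commute_map_veeLeft_veeRight
    (Matrix.unitaryGroup.eventually_eq_one_of_pow_three) (ψ n) (γ := γ) (l := l)
    (by simpa using zpow_ne_one_of_toAdd_ne_zero hγ one_ne_zero)
    (by simpa [zpow_ofNat, pow_two] using zpow_ne_one_of_toAdd_ne_zero hγ two_ne_zero)
    (fun m hm => by
      simpa using zpow_ne_one_of_toAdd_ne_zero hl (m := (m : ℤ)) (by exact_mod_cast hm))
  set t : ℝ := ((d * e : ℤ) : ℝ) * (2 * Real.pi / (n + 1)) with ht
  have habs : |t| < 1 / 10 := by
    rw [ht, abs_mul, abs_of_nonneg (by positivity : 0 ≤ 2 * Real.pi / ((n : ℝ) + 1))]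
    calc _ = |((d * e : ℤ) : ℝ)| * (2 * Real.pi) * (1 / ((n : ℝ) + 1)) := by ring
      _ < _ := hzn
  have hrel : v n ^ e * u n ^ d = scalarUnitary _ (Circle.exp t) * (u n ^ d * v n ^ e) := by
    rw [zpow_mul_zpow_of_central (commute_scalarUnitary _) (huv n), ht, ← zsmul_eq_mul,
      Circle.exp_zsmul, map_zpow]
  have hone := eq_one_of_near_commuting (u n ^ d).2 (v n ^ e).2 (ψ n (veeLeft Γ Λ γ)).2
    (ψ n (veeRight Γ Λ l)).2 (z := Circle.exp t)
    ((congrArg Subtype.val hrel).trans (coe_scalarUnitary_mul _ _))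
    ((norm_coe_circle_exp_sub_one_le t).trans habs.le) (congrArg Subtype.val hcomm)
    ((norm_le_schattenNorm hp0 _).trans hXn.le) ((norm_le_schattenNorm hp0 _).trans hYn.le)
  -- The scalar is 1, so t lies in 2πℤ, although 0 < |t| < 1/10.
  obtain ⟨k, hk⟩ := Circle.exp_eq_one.1 (Circle.coe_eq_one.1 hone)
  have ht0 : t ≠ 0 := by
    have : ((d * e : ℤ) : ℝ) ≠ 0 := by exact_mod_cast mul_ne_zero hγ hl
    positivity
  have hk0 : k ≠ 0 := by
    rintro rfl
    simp [ht0] at hk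
  have hk1 : (1 : ℝ) ≤ |(k : ℝ)| := by exact_mod_cast Int.one_le_abs hk0
  rw [hk, abs_mul, abs_of_pos Real.two_pi_pos] at habs
  nlinarith [Real.pi_gt_three]

end Main
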